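/- Let $(X,d)$ be a metric space. All quantities below take values in $[0,\infty]$, with $\sup\emptyset=0$ and $\inf\emptyset=\infty$. For $A\subseteq X$, the outer linear measure (one-dimensional Hausdorff outer measure) of $A$ is \[ L^*(A)=\sup_{\delta>0}\ \inf\Bigl\{\sum_{i\in\mathbb N}\operatorname{diam}(U_i) : U_i\subseteq X,\ A\subseteq\bigcup_{i\in\mathbb N}U_i,\ \operatorname{diam}(U_i)\le\delta\text{ for all }i\Bigr\}. \] For a finite simple graph $G=(V,E)$ whose vertex set $V$ is a non-empty finite subset of $X$, put $\ell(G)=\sum_{\{a,b\}\in E}d(a,b)$. For a finite non-empty set $P\subseteq X$ and a set $A\subseteq X$ define \[ \operatorname{smt}(P)=\inf\{\ell(G): G=(V,E)\text{ is connected},\ P\subseteq V\subseteq X\}, \] \[ \operatorname{smt}_A(P)=\inf\{\ell(G): G=(V,E)\text{ is connected},\ P\subseteq V\subseteq X,\ V\setminus P\subseteq A\}. \] The Menger--Choquet length and the intrinsic Menger length of $A\subseteq X$ are \[ L_{MC}(A)=\sup\{\operatorname{smt}(P): P\subseteq A\text{ finite, non-empty}\},\qquad L_{IM}(A)=\sup\{\operatorname{smt}_A(P):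 P\subseteq A\text{ finite, non-empty}\}. \] \textbf{Theorem.} For every metric space $X$ and every subset $A\subseteq X$, \[ L^*(A)\le L_{MC}(A)\le L_{IM}(A). \] If, moreover, $A$ is connected (the empty set being allowed), then \[ L^*(A)=L_{MC}(A)=L_{IM}(A). \] -/

import Mathlib

open scoped ENNReal NNReal

/-- `L*_δ(A)`: the infimum of `∑ diam (U i)` over the countable `δ`-covers `(U i)` of `A`. -/
noncomputable def outerLinearPremeasure {X : Type*} [MetricSpace X] (δ : ℝ≥0) (A : Set X) :
    ℝ≥0∞ :=
  ⨅ (U : ℕ → Set X) (_ : A ⊆ ⋃ i, U i) (_ : ∀ i, Metric.ediam (U i) ≤ δ),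
    ∑' i, Metric.ediam (U i)

/-- Outer linear measure `L*(A)`, i.e. one-dimensional Hausdorff outer measure
(see `outerLinearMeasure_eq_hausdorffMeasure`). -/
noncomputable def outerLinearMeasure {X : Type*} [MetricSpace X] (A : Set X) : ℝ≥0∞ :=
  ⨆ (δ : ℝ≥0) (_ : 0 < δ), outerLinearPremeasure δ A

/-- The outer linear measure is Mathlib's one-dimensional Hausdorff measure. -/
theorem outerLinearMeasure_eq_hausdorffMeasure {X : Type*} [MetricSpace X]
    [MeasurableSpace X] [BorelSpace X] (A : Set X) :
    outerLinearMeasure A = MeasureTheory.Measure.hausdorffMeasure 1 A := by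
  have key : ∀ s : Set X, (⨆ _ : s.Nonempty, Metric.ediam s ^ (1 : ℝ)) = Metric.ediam s := by
    intro s
    rcases s.eq_empty_or_nonempty with rfl | h
    · simp
    · simp [h]
  rw [MeasureTheory.Measure.hausdorffMeasure_apply]
  simp only [key, outerLinearMeasure, outerLinearPremeasure]
  apply le_antisymm
  · refine iSup₂_le fun δ hδ => ?_
    exact le_iSup₂_of_le (δ : ℝ≥0∞) (by exact_mod_cast hδ) le_rfl
  · refine iSup₂_le fun r hr => ?_
    obtain ⟨δ, hδ, hδr⟩ := ENNReal.lt_iff_exists_nnreal_btwn.1 hr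
    refine le_iSup₂_of_le δ (by exact_mod_cast hδ) ?_
    refine iInf_mono fun U => iInf_mono fun _ => ?_
    exact le_iInf fun h => iInf_le_of_le (fun i => (h i).trans hδr.le) le_rfl

/-- The distance between the two endpoints of an unordered pair of points. -/
noncomputable def edgeLength {Y : Type*} [MetricSpace Y] : Sym2 Y → ℝ≥0∞ :=
  Sym2.lift ⟨fun a b => edist a b, fun a b => edist_comm a b⟩

open scoped Classical in
/-- The length `ℓ(G)` of a graph `G` on a finite set `V` of points of a metric space: the sum
of `d(a, b)` over all edges `{a, b}` of `G`. -/
noncomputable def graphLength {X : Type*} [MetricSpace X] {V : Finset X} (G : SimpleGraph V) :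
    ℝ≥0∞ :=
  ∑ e ∈ G.edgeFinset, edgeLength e

/-- `smt(P)`: the infimum of the lengths of connected graphs on finite vertex sets `V` with
`P ⊆ V ⊆ X`. -/
noncomputable def smt {X : Type*} [MetricSpace X] (P : Finset X) : ℝ≥0∞ :=
  ⨅ (V : Finset X) (_ : P ⊆ V) (G : SimpleGraph V) (_ : G.Connected), graphLength G

/-- `smt_A(P)`: as `smt(P)`, with all Steiner points (the points of `V \ P`) in `A`. -/
noncomputable def smtIn {X : Type*} [MetricSpace X] (A : Set X) (P : Finset X) : ℝ≥0∞ :=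
  ⨅ (V : Finset X) (_ : P ⊆ V) (_ : (V : Set X) \ (P : Set X) ⊆ A)
    (G : SimpleGraph V) (_ : G.Connected), graphLength G

/-- Menger–Choquet length `L_MC(A)`. -/
noncomputable def mengerChoquetLength {X : Type*} [MetricSpace X] (A : Set X) : ℝ≥0∞ :=
  ⨆ (P : Finset X) (_ : P.Nonempty) (_ : (P : Set X) ⊆ A), smt P

/-- Intrinsic Menger length `L_IM(A)`. As for `L_MC`, the finite sets `P` are non-empty; this
makes a difference only for `A = ∅`, where it gives the value `0`. -/
noncomputable def intrinsicMengerLength {X : Type*} [MetricSpace X] (A : Set X) : ℝ≥0∞ :=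
  ⨆ (P : Finset X) (_ : P.Nonempty) (_ : (P : Set X) ⊆ A), smtIn A P

/-! A nearly optimal graph for a finite P ⊆ A contains a spanning tree. Cutting this tree into
pieces of diameter at most δ, each but one using up at least δ/2 of length, bounds their number in
terms of δ and `mengerChoquetLength A` alone (`MetricTree.exists_pieces`). With this number fixed, a
compactness argument yields one such cover of all of A (`exists_cover_of_finite_subsets`), hence L*
≤ L_MC.

For connected A, thicken a fine cover to an open one. Any two members meeting A are linked by a
chain whose consecutive members meet inside A. Choosing points in these intersections gives a tree
in A through P. Each member pays by its diameter for at most one edge, and the remaining edges, at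
most one per point of P, cost at most the mesh δ each (`exists_metricTree_of_open_cover`). As δ → 0
this gives L_IM ≤ L*. -/

/-! ### Metric trees and connected graphs -/

/-- `MetricTree r V l`: there is a tree with root `r` and vertex set `V` whose edges have total
length `l`. A tree is a single vertex, or arises from two trees by joining their roots. -/
inductive MetricTree {X : Type*} [MetricSpace X] : X → Set X → ℝ≥0∞ → Prop
  | single (r : X) : MetricTree r {r} 0
  | join {r s : X} {V W : Set X} {l m : ℝ≥0∞} (hV : MetricTree r V l) (hW : MetricTree s W m) :
      MetricTree r (V ∪ W) (l + m + edist r s)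

namespace MetricTree

variable {X : Type*} [MetricSpace X]

theorem root_mem {r : X} {V : Set X} {l : ℝ≥0∞} (h : MetricTree r V l) : r ∈ V := by
  induction h with
  | single r => rfl
  | join _ _ h _ => exact Or.inl h

theorem finite {r : X} {V : Set X} {l : ℝ≥0∞} (h : MetricTree r V l) : V.Finite := by
  induction h with
  | single r => exact Set.finite_singleton r
  | join _ _ h h' => exact h.union h'

/-- A tree can be attached to any vertex of another tree. -/
theorem attach {r s v : X} {V W : Set X} {l m : ℝ≥0∞} (hV : MetricTree r V l)
    (hv : v ∈ V) (hW : MetricTree s W m) : MetricTree r (V ∪ W) (l + m + edist v s) := by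
  induction hV with
  | single r =>
    obtain rfl : v = r := hv
    exact join (single v) hW
  | @join r t V₁ V₂ l₁ l₂ h₁ h₂ ih₁ ih₂ =>
    rcases hv with hv | hv
    · have := join (ih₁ hv) h₂
      rw [Set.union_right_comm] at this
      convert this using 1
      ring
    · have := join h₁ (ih₂ hv)
      rw [← Set.union_assoc] at this
      convert this using 1
      ring

theorem attach_leaf {r v x : X} {V : Set X} {l : ℝ≥0∞} (hV : MetricTree r V l) (hv : v ∈ V) :
    MetricTree r (insert x V) (l + edist v x) := by
  simpa using hV.attach hv (single x)

/-- A connected graph contains a tree on all its vertices which is at most as long. -/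
theorem exists_of_connected {V : Finset X} (G : SimpleGraph V) (hG : G.Connected) (r : V) :
    ∃ l ≤ graphLength G, MetricTree (r : X) (V : Set X) l := by
  classical
  -- Only edges of G inside S are charged, so an edge leaving a maximal S ≠ V would be uncharged and
  -- would extend the tree.
  let Q : Finset V → Prop := fun S => r ∈ S ∧ ∃ l, MetricTree (r : X) ((↑) '' (S : Set V)) l ∧
    l ≤ ∑ e ∈ G.edgeFinset with (∀ x ∈ e, x ∈ S), edgeLength e
  have hQ : Q {r} := ⟨by simp, 0, by simpa using single (r : X), zero_le⟩
  obtain ⟨S, hS⟩ := Set.Finite.exists_maximal (Set.toFinite {S | Q S}) ⟨_, hQ⟩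
  obtain ⟨hrS, l, hl, hle⟩ := hS.prop
  have hSuniv : S = Finset.univ := by
    by_contra hne
    obtain ⟨v, hv⟩ : ∃ v, v ∉ S := by
      by_contra! h
      exact hne (Finset.eq_univ_of_forall h)
    obtain ⟨p⟩ := hG.preconnected r v
    obtain ⟨d, -, hd, hd'⟩ := p.exists_boundary_dart (S : Set V) hrS hv
    have hQ' : Q (insert d.snd S) := by
      refine ⟨Finset.mem_insert_of_mem hrS, l + edist (d.fst : X) d.snd, ?_, ?_⟩
      · have := hl.attach_leaf (x := (d.snd : X)) (Set.mem_image_of_mem _ hd)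
        simpa [Set.image_insert_eq] using this
      · have hnot : s(d.fst, d.snd) ∉ G.edgeFinset.filter (fun e => ∀ x ∈ e, x ∈ S) := by
          intro h
          exact hd' ((Finset.mem_filter.1 h).2 d.snd (Sym2.mem_mk_right _ _))
        calc l + edist (d.fst : X) d.snd
            ≤ edgeLength s(d.fst, d.snd) +
              ∑ e ∈ G.edgeFinset with (∀ x ∈ e, x ∈ S), edgeLength e := by
              rw [add_comm]
              exact add_le_add le_rfl hle
          _ = ∑ e ∈ insert s(d.fst, d.snd) (G.edgeFinset.filter (fun e => ∀ x ∈ e, x ∈ S)),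
                edgeLength e := (Finset.sum_insert hnot).symm
          _ ≤ _ := by
              refine Finset.sum_le_sum_of_subset ?_
              intro e he
              rcases Finset.mem_insert.1 he with rfl | he
              · refine Finset.mem_filter.2 ⟨by simp, ?_⟩
                intro x hx
                rcases Sym2.mem_iff.1 hx with rfl | rfl
                · exact Finset.mem_insert_of_mem hd
                · exact Finset.mem_insert_self _ _
              · rw [Finset.mem_filter] at he ⊢
                exact ⟨he.1, fun x hx => Finset.mem_insert_of_mem (he.2 x hx)⟩
    exact hd' (hS.le_of_ge hQ' (Finset.subset_insert _ _) (Finset.mem_insert_self _ _))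
  subst hSuniv
  refine ⟨l, hle.trans (Finset.sum_le_sum_of_subset (Finset.filter_subset _ _)), ?_⟩
  simpa using hl

/-- The edges of a tree: a finite set of pairs connecting the root to all vertices. -/
theorem exists_edges {r : X} {V : Set X} {l : ℝ≥0∞} (h : MetricTree r V l) :
    ∃ E : Finset (Sym2 X), ∑ e ∈ E, edgeLength e ≤ l ∧
      ∀ (V' : Set X) (hV' : V ⊆ V') (G : SimpleGraph V'),
        (∀ a b : V', a ≠ b → s((a : X), (b : X)) ∈ E → G.Adj a b) →
        ∀ (x : X) (hx : x ∈ V), G.Reachable ⟨r, hV' h.root_mem⟩ ⟨x, hV' hx⟩ := by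
  classical
  induction h with
  | single r =>
    refine ⟨∅, by simp, ?_⟩
    rintro V' hV' G - x rfl
    rfl
  | @join r s V W l m hV hW ihV ihW =>
    obtain ⟨E, hE, hEc⟩ := ihV
    obtain ⟨F, hF, hFc⟩ := ihW
    refine ⟨insert s(r, s) (E ∪ F), ?_, ?_⟩
    -- Only inequalities hold: a pair occurring twice in the tree is counted once in the edge set.
    · calc _ ≤ edgeLength s(r, s) + ∑ e ∈ E ∪ F, edgeLength e := by
            rw [Finset.insert_eq, ← Finset.sum_singleton edgeLength s(r, s),
              ← Finset.sum_union_inter]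
            exact le_self_add
        _ ≤ edgeLength s(r, s) + (∑ e ∈ E, edgeLength e + ∑ e ∈ F, edgeLength e) := by
            gcongr
            rw [← Finset.sum_union_inter]
            exact le_self_add
        _ ≤ edist r s + (l + m) := add_le_add le_rfl (add_le_add hE hF)
        _ = _ := add_comm _ _
    -- Since V' and G are arbitrary, both induction hypotheses apply in the graph of the whole tree.
    · intro V' hV' G hG x hx
      rcases hx with hx | hx
      · exact hEc V' (Set.subset_union_left.trans hV') G
          (fun a b hab h => hG a b hab (by simp [h])) x hx
      · have h₁ := hFc V' (Set.subset_union_right.trans hV') G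
          (fun a b hab h => hG a b hab (by simp [h])) x hx
        refine SimpleGraph.Reachable.trans ?_ h₁
        by_cases hrs : r = s
        · subst hrs
          rfl
        · exact (hG _ _ (fun h => hrs (congrArg Subtype.val h)) (by simp)).reachable

/-- Every tree is a connected graph. -/
theorem exists_graph {r : X} {V : Finset X} {l : ℝ≥0∞} (h : MetricTree r (V : Set X) l) :
    ∃ G : SimpleGraph V, G.Connected ∧ graphLength G ≤ l := by
  classical
  obtain ⟨E, hE, hc⟩ := h.exists_edges
  let G : SimpleGraph V := SimpleGraph.fromEdgeSet {e | e.map Subtype.val ∈ E}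
  refine ⟨G, ?_, ?_⟩
  · have hr : ∀ x : V, G.Reachable ⟨r, h.root_mem⟩ x := fun x =>
      hc V subset_rfl G (fun a b hab hab' => by
        simpa [G, hab] using hab') x x.2
    have : Nonempty V := ⟨⟨r, h.root_mem⟩⟩
    exact ⟨fun x y => (hr x).symm.trans (hr y)⟩
  · refine le_trans ?_ hE
    have hinj : Function.Injective (Sym2.map (Subtype.val : V → X)) :=
      Sym2.map.injective Subtype.val_injective
    have hlen : ∀ e : Sym2 V, edgeLength e = edgeLength (e.map Subtype.val) := by
      intro e
      induction e with
      | _ a b => rfl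
    calc graphLength G = ∑ e ∈ G.edgeFinset, edgeLength (e.map Subtype.val) :=
          Finset.sum_congr (by ext; simp) fun e _ => hlen e
      _ = ∑ e ∈ G.edgeFinset.image (Sym2.map Subtype.val), edgeLength e :=
          (Finset.sum_image fun _ _ _ _ h => hinj h).symm
      _ ≤ _ := by
          refine Finset.sum_le_sum_of_subset ?_
          intro e he
          obtain ⟨e, he', rfl⟩ := Finset.mem_image.1 he
          have := SimpleGraph.mem_edgeFinset.1 he'
          rw [SimpleGraph.edgeSet_fromEdgeSet] at this
          exact this.1

theorem smtIn_le {r : X} {V A : Set X} {l : ℝ≥0∞} (h : MetricTree r V l) {P : Finset X}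
    (hP : (P : Set X) ⊆ V) (hV : V ⊆ A) : smtIn A P ≤ l := by
  lift V to Finset X using h.finite
  obtain ⟨G, hG, hGl⟩ := h.exists_graph
  exact iInf_le_of_le V <| iInf_le_of_le (Finset.coe_subset.1 hP) <|
    iInf_le_of_le (Set.sdiff_subset.trans hV) <| iInf_le_of_le G <| iInf_le_of_le hG hGl

/-! ### Cutting trees into small pieces -/

/-- A tree can be cut into pieces of diameter at most `δ`, all of which but the piece of the root
account for at least `δ / 2` of its length. -/
theorem exists_pieces {r : X} {V : Set X} {l : ℝ≥0∞} (h : MetricTree r V l) (δ : ℝ≥0) :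
    ∃ (L : List (Set X)) (R : Set X) (w : ℝ≥0∞), r ∈ R ∧ (∀ x ∈ V, x ∈ R ∨ ∃ B ∈ L, x ∈ B) ∧
      Metric.ediam R ≤ w ∧ w ≤ δ / 2 ∧ (∀ B ∈ L, Metric.ediam B ≤ δ) ∧
      w + (L.map Metric.ediam).sum ≤ l ∧ w + L.length * (δ / 2) ≤ l := by
  induction h with
  | single r => exact ⟨[], {r}, 0, by simp, by simp, by simp, by simp, by simp, by simp, by simp⟩
  | @join r s V₁ V₂ l₁ l₂ _ _ ih₁ ih₂ =>
    obtain ⟨L₁, R₁, w₁, hr₁, hc₁, hd₁, hw₁, hB₁, hs₁, hn₁⟩ := ih₁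
    obtain ⟨L₂, R₂, w₂, hr₂, hc₂, hd₂, hw₂, hB₂, hs₂, hn₂⟩ := ih₂
    have hdiam : Metric.ediam (R₁ ∪ R₂) ≤ w₁ + edist r s + w₂ :=
      (Metric.ediam_union_le_add_edist hr₁ hr₂).trans (add_le_add (add_le_add hd₁ le_rfl) hd₂)
    have hL : ∀ B ∈ L₁ ++ L₂, Metric.ediam B ≤ δ := fun B hB =>
      (List.mem_append.1 hB).elim (hB₁ B) (hB₂ B)
    have hS : w₁ + edist r s + w₂ + ((L₁ ++ L₂).map Metric.ediam).sum ≤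
        l₁ + l₂ + edist r s := by
      calc _ = (w₁ + (L₁.map Metric.ediam).sum) + (w₂ + (L₂.map Metric.ediam).sum) +
            edist r s := by
            rw [List.map_append, List.sum_append]
            ring
        _ ≤ _ := by gcongr
    have hN : w₁ + edist r s + w₂ + (L₁ ++ L₂).length * (δ / 2) ≤ l₁ + l₂ + edist r s := by
      calc _ = (w₁ + L₁.length * (δ / 2)) + (w₂ + L₂.length * (δ / 2)) + edist r s := by
            rw [List.length_append]
            push_cast
            ring
        _ ≤ _ := by gcongr
    -- Here w is the length reserved for the root piece. A joined piece within δ/2 stays the root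
    -- piece; one between δ/2 and δ is cut off, and the root restarts as {r} with w = 0; beyond δ,
    -- only R₂ is cut off, paid for by w₂ and the joining edge.
    by_cases h₁ : w₁ + edist r s + w₂ ≤ δ / 2
    · refine ⟨L₁ ++ L₂, R₁ ∪ R₂, w₁ + edist r s + w₂, Or.inl hr₁, ?_, hdiam, h₁, hL, hS, hN⟩
      rintro x (hx | hx)
      · rcases hc₁ x hx with h | ⟨B, hB, h⟩
        · exact Or.inl (Or.inl h)
        · exact Or.inr ⟨B, List.mem_append_left _ hB, h⟩
      · rcases hc₂ x hx with h | ⟨B, hB, h⟩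
        · exact Or.inl (Or.inr h)
        · exact Or.inr ⟨B, List.mem_append_right _ hB, h⟩
    · by_cases h₂ : w₁ + edist r s + w₂ ≤ δ
      · refine ⟨(R₁ ∪ R₂) :: (L₁ ++ L₂), {r}, 0, rfl, ?_, by simp, zero_le, ?_, ?_, ?_⟩
        · rintro x (hx | hx)
          · rcases hc₁ x hx with h | ⟨B, hB, h⟩
            · exact Or.inr ⟨_, List.mem_cons_self, Or.inl h⟩
            · exact Or.inr ⟨B, by simp [hB], h⟩
          · rcases hc₂ x hx with h | ⟨B, hB, h⟩
            · exact Or.inr ⟨_, List.mem_cons_self, Or.inr h⟩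
            · exact Or.inr ⟨B, by simp [hB], h⟩
        · intro B hB
          rcases List.mem_cons.1 hB with rfl | hB
          · exact hdiam.trans h₂
          · exact hL B hB
        · rw [List.map_cons, List.sum_cons, zero_add]
          exact (add_le_add hdiam le_rfl).trans hS
        · refine le_trans ?_ hN
          rw [List.length_cons, zero_add, Nat.cast_add, Nat.cast_one, add_mul, one_mul, add_comm]
          exact add_le_add (not_le.1 h₁).le le_rfl
      · have h₃ : (δ / 2 : ℝ≥0∞) ≤ edist r s + w₂ := by
          by_contra! hlt
          refine h₂ ?_
          calc w₁ + edist r s + w₂ = w₁ + (edist r s + w₂) := add_assoc _ _ _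
            _ ≤ δ / 2 + δ / 2 := add_le_add hw₁ hlt.le
            _ = δ := ENNReal.add_halves _
        refine ⟨R₂ :: (L₁ ++ L₂), R₁, w₁, hr₁, ?_, hd₁, hw₁, ?_, ?_, ?_⟩
        · rintro x (hx | hx)
          · rcases hc₁ x hx with h | ⟨B, hB, h⟩
            · exact Or.inl h
            · exact Or.inr ⟨B, by simp [hB], h⟩
          · rcases hc₂ x hx with h | ⟨B, hB, h⟩
            · exact Or.inr ⟨_, List.mem_cons_self, h⟩
            · exact Or.inr ⟨B, by simp [hB], h⟩
        · intro B hB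
          rcases List.mem_cons.1 hB with rfl | hB
          · exact hd₂.trans (hw₂.trans ENNReal.half_le_self)
          · exact hL B hB
        · refine le_trans ?_ hS
          rw [List.map_cons, List.sum_cons, ← add_assoc]
          refine add_le_add ?_ le_rfl
          rw [add_assoc]
          exact add_le_add le_rfl (hd₂.trans le_add_self)
        · refine le_trans ?_ hN
          rw [List.length_cons, Nat.cast_add, Nat.cast_one, add_mul, one_mul,
            add_comm _ (δ / 2 : ℝ≥0∞), ← add_assoc, add_assoc w₁ (edist r s)]
          exact add_le_add (add_le_add le_rfl h₃) le_rfl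

/-- A tree of length at most `M` is covered by a number of sets of diameter at most `δ` that
depends only on `M` and `δ`, the sum of the diameters being at most `M`. -/
theorem exists_cover (M δ : ℝ≥0) (hδ : 0 < δ) :
    ∃ N : ℕ, 0 < N ∧ ∀ (r : X) (V : Set X) (l : ℝ≥0∞), MetricTree r V l → l ≤ M →
      ∃ B : Fin N → Set X, V ⊆ ⋃ i, B i ∧ (∀ i, Metric.ediam (B i) ≤ δ) ∧
        ∑ i, Metric.ediam (B i) ≤ M := by
  obtain ⟨n, hn⟩ := exists_nat_gt (M / (δ / 2))
  refine ⟨n + 1, n.succ_pos, fun r V l h hl => ?_⟩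
  obtain ⟨L, R, w, -, hc, hd, hw, hB, hs, hlen⟩ := h.exists_pieces δ
  have hLn : L.length < n := by
    have h₁ : (L.length : ℝ≥0∞) * (δ / 2) ≤ M := le_add_self.trans (hlen.trans hl)
    have h₂ : (L.length : ℝ≥0) * (δ / 2) ≤ M := by
      rw [← ENNReal.coe_le_coe]
      push_cast
      exact h₁
    have h₃ : (L.length : ℝ≥0) ≤ M / (δ / 2) := (le_div_iff₀ (by positivity)).2 h₂
    exact_mod_cast h₃.trans_lt hn
  -- The default ∅, of diameter 0, pads the list of pieces to exactly n + 1 sets.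
  have hget : ∀ (K : List (Set X)) (i : ℕ), K.getD i ∅ = ∅ ∨ K.getD i ∅ ∈ K := by
    intro K i
    by_cases hi : i < K.length
    · rw [List.getD_eq_getElem _ _ hi]
      exact Or.inr (List.getElem_mem hi)
    · exact Or.inl (List.getD_eq_default _ _ (not_lt.1 hi))
  have hsum : ∀ (K : List (Set X)) (k : ℕ),
      ∑ i ∈ Finset.range k, Metric.ediam (K.getD i ∅) ≤ (K.map Metric.ediam).sum := by
    intro K
    induction K with
    | nil => simp
    | cons B K ih =>
      intro k
      cases k with
      | zero => simp
      | succ k =>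
        rw [Finset.sum_range_succ', add_comm]
        simpa using add_le_add (le_refl (Metric.ediam B)) (ih k)
  refine ⟨fun i => (R :: L).getD i ∅, ?_, ?_, ?_⟩
  · intro x hx
    have : ∃ B ∈ R :: L, x ∈ B := by
      rcases hc x hx with h | ⟨B, hB, h⟩
      · exact ⟨R, by simp, h⟩
      · exact ⟨B, by simp [hB], h⟩
    obtain ⟨B, hB, hx⟩ := this
    obtain ⟨i, hi, rfl⟩ := List.mem_iff_getElem.1 hB
    refine Set.mem_iUnion.2 ⟨⟨i, by simp at hi; omega⟩, ?_⟩
    rw [List.getD_eq_getElem _ _ hi]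
    exact hx
  · intro i
    rcases hget (R :: L) i with h | h
    · simp only [h, Metric.ediam_empty, zero_le]
    · rcases List.mem_cons.1 h with h | h
      · simp only [h]
        exact hd.trans (hw.trans ENNReal.half_le_self)
      · exact hB _ h
  · rw [Fin.sum_univ_eq_sum_range (fun i => Metric.ediam ((R :: L).getD i ∅)) (n + 1)]
    refine (hsum _ _).trans ?_
    rw [List.map_cons, List.sum_cons]
    exact (add_le_add hd le_rfl).trans (hs.trans hl)

end MetricTree

/-! ### Compactness and the lower bound for Menger–Choquet length -/

section Cover

variable {X : Type*} [MetricSpace X]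

/-- Finite covers with a fixed number of members pass from the finite subsets of a set to the
set itself. -/
theorem exists_cover_of_finite_subsets {A : Set X} {N : ℕ} (hN : 0 < N) {δ M : ℝ≥0∞}
    (h : ∀ P : Finset X, (P : Set X) ⊆ A → ∃ B : Fin N → Set X, (P : Set X) ⊆ ⋃ i, B i ∧
      (∀ i, Metric.ediam (B i) ≤ δ) ∧ ∑ i, Metric.ediam (B i) ≤ M) :
    ∃ B : Fin N → Set X, A ⊆ ⋃ i, B i ∧ (∀ i, Metric.ediam (B i) ≤ δ) ∧
      ∑ i, Metric.ediam (B i) ≤ M := by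
  classical
  have : Nonempty (Fin N) := ⟨⟨0, hN⟩⟩
  have h' : ∀ t : Finset A, ∃ (B : Fin N → Set X) (g : A → Fin N), (∀ x ∈ t, (x : X) ∈ B (g x)) ∧
      (∀ i, Metric.ediam (B i) ≤ δ) ∧ ∑ i, Metric.ediam (B i) ≤ M := by
    intro t
    obtain ⟨B, hB, hd, hs⟩ := h (t.map (Function.Embedding.subtype _)) (by
      intro x hx
      obtain ⟨y, -, rfl⟩ := Finset.mem_map.1 (Finset.mem_coe.1 hx)
      exact y.2)
    have : ∀ x : A, ∃ i, x ∈ t → (x : X) ∈ B i := by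
      intro x
      by_cases hx : x ∈ t
      · obtain ⟨i, hi⟩ := Set.mem_iUnion.1
          (hB (Finset.mem_coe.2 (Finset.mem_map_of_mem (Function.Embedding.subtype _) hx)))
        exact ⟨i, fun _ => hi⟩
      · exact ⟨Classical.arbitrary _, fun h => absurd h hx⟩
    choose g hg using this
    exact ⟨B, g, hg, hd, hs⟩
  choose B g hg hd hs using h'
  -- Rado selection: on each finite s, χ agrees with the assignment g t for some t ⊇ s, so the
  -- classes of χ in s lie in the members of B t.
  obtain ⟨χ, hχ⟩ := Finset.rado_selection (β := fun _ : A => Fin N) g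
  have key : ∀ s : Finset A, ∃ t, ∀ i, (↑) '' {x : A | x ∈ s ∧ χ x = i} ⊆ B t i := by
    intro s
    obtain ⟨t, hst, ht⟩ := hχ s
    refine ⟨t, fun i => ?_⟩
    rintro _ ⟨x, ⟨hx, rfl⟩, rfl⟩
    rw [ht x hx]
    exact hg t x (hst hx)
  -- A diameter is determined by pairs of points, hence by finite subsets.
  have hsup : ∀ i, Metric.ediam ((↑) '' {x : A | χ x = i} : Set X) ≤
      ⨆ s : Finset A, Metric.ediam ((↑) '' {x : A | x ∈ s ∧ χ x = i} : Set X) := by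
    intro i
    refine Metric.ediam_le ?_
    rintro _ ⟨x, hx, rfl⟩ _ ⟨y, hy, rfl⟩
    refine le_iSup_of_le {x, y} (Metric.edist_le_ediam_of_mem ?_ ?_)
    · exact ⟨x, ⟨by simp, hx⟩, rfl⟩
    · exact ⟨y, ⟨by simp, hy⟩, rfl⟩
  refine ⟨fun i => (↑) '' {x : A | χ x = i}, ?_, ?_, ?_⟩
  · intro x hx
    exact Set.mem_iUnion.2 ⟨χ ⟨x, hx⟩, ⟨x, hx⟩, rfl, rfl⟩
  · intro i
    refine (hsup i).trans (iSup_le fun s => ?_)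
    obtain ⟨t, ht⟩ := key s
    exact (Metric.ediam_mono (ht i)).trans (hd t i)
  · refine (Finset.sum_le_sum fun i _ => hsup i).trans ?_
    -- Monotonicity in s lets one s serve all classes at once, so the bound on the sum survives the
    -- supremum.
    rw [ENNReal.finsetSum_iSup_of_monotone]
    · refine iSup_le fun s => ?_
      obtain ⟨t, ht⟩ := key s
      exact (Finset.sum_le_sum fun i _ => Metric.ediam_mono (ht i)).trans (hs t)
    · intro i s t hst
      exact Metric.ediam_mono (Set.image_mono fun x hx => ⟨hst hx.1, hx.2⟩)

theorem outerLinearPremeasure_le_of_fin_cover {A : Set X} {δ : ℝ≥0} {N : ℕ} (B : Fin N → Set X)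
    (hA : A ⊆ ⋃ i, B i) (hd : ∀ i, Metric.ediam (B i) ≤ δ) :
    outerLinearPremeasure δ A ≤ ∑ i, Metric.ediam (B i) := by
  let U : ℕ → Set X := fun i => if hi : i < N then B ⟨i, hi⟩ else ∅
  have hU : ∀ i : Fin N, U i = B i := fun i => dif_pos i.2
  have hU' : ∀ i, ¬ i < N → U i = ∅ := fun i hi => dif_neg hi
  refine iInf_le_of_le U (iInf_le_of_le ?_ (iInf_le_of_le ?_ ?_))
  · intro x hx
    obtain ⟨i, hi⟩ := Set.mem_iUnion.1 (hA hx)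
    exact Set.mem_iUnion.2 ⟨i, (hU i).symm ▸ hi⟩
  · intro i
    by_cases hi : i < N
    · exact (hU ⟨i, hi⟩).symm ▸ hd ⟨i, hi⟩
    · rw [hU' i hi, Metric.ediam_empty]
      exact zero_le
  · rw [tsum_eq_sum (s := Finset.range N), ← Fin.sum_univ_eq_sum_range
      (fun i => Metric.ediam (U i)) N]
    · exact le_of_eq (Finset.sum_congr rfl fun i _ => by rw [hU])
    · intro i hi
      rw [hU' i (by simpa using hi), Metric.ediam_empty]

theorem outerLinearMeasure_le_mengerChoquetLength (A : Set X) :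
    outerLinearMeasure A ≤ mengerChoquetLength A := by
  refine ENNReal.le_of_forall_pos_le_add fun ε hε hfin => iSup₂_le fun δ hδ => ?_
  lift mengerChoquetLength A to ℝ≥0 using hfin.ne with M hM
  obtain ⟨N, hN, hcov⟩ := MetricTree.exists_cover (X := X) (M + ε) δ hδ
  obtain ⟨B, hB, hd, hs⟩ := exists_cover_of_finite_subsets (A := A) (δ := δ) (M := (M + ε : ℝ≥0)) hN
    (fun P hP => by
      rcases P.eq_empty_or_nonempty with rfl | hne
      · exact ⟨fun _ => ∅, by simp, by simp, by simp⟩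
      have hlt : smt P < (M + ε : ℝ≥0) := by
        have h₁ : smt P ≤ M := by
          rw [hM]
          exact le_iSup_of_le P (le_iSup₂_of_le hne hP le_rfl)
        refine h₁.trans_lt ?_
        exact_mod_cast lt_add_of_pos_right M hε
      simp only [smt, iInf_lt_iff] at hlt
      obtain ⟨V, hPV, G, hG, hGl⟩ := hlt
      obtain ⟨r⟩ := hG.nonempty
      obtain ⟨l, hl, ht⟩ := MetricTree.exists_of_connected G hG r
      obtain ⟨B, hB, hd, hs⟩ := hcov r V l ht (hl.trans hGl.le)
      exact ⟨B, subset_trans (by exact_mod_cast hPV) hB, hd, hs⟩)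
  refine (outerLinearPremeasure_le_of_fin_cover B hB hd).trans (hs.trans ?_)
  push_cast
  rfl

/-- Restricting the Steiner points to A only shrinks the family of competing graphs. -/
theorem mengerChoquetLength_le_intrinsicMengerLength (A : Set X) :
    mengerChoquetLength A ≤ intrinsicMengerLength A :=
  iSup_mono fun _ => iSup₂_mono fun _ _ =>
    iInf_mono fun _ => iInf_mono fun _ => le_iInf fun _ => le_rfl

end Cover

/-! ### Chains in the nerve of an open cover -/

/-- `NerveChain A W S F i`: the indices in `F` form a chain without repetition outside `S`, which
starts next to `S` and ends with `i`, and consecutive members of `W` meet inside `A`. -/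
inductive NerveChain {X : Type*} (A : Set X) (W : ℕ → Set X) (S : Finset ℕ) :
    Finset ℕ → ℕ → Prop
  | start {i j : ℕ} (hi : i ∉ S) (hj : j ∈ S) (h : (A ∩ (W i ∩ W j)).Nonempty) :
      NerveChain A W S {i} i
  | step {F : Finset ℕ} {i j : ℕ} (hF : NerveChain A W S F i) (hj : j ∉ S) (hjF : j ∉ F)
      (h : (A ∩ (W i ∩ W j)).Nonempty) : NerveChain A W S (insert j F) j

namespace NerveChain

variable {X : Type*} {A : Set X} {W : ℕ → Set X} {S : Finset ℕ}

theorem disjoint {F : Finset ℕ} {i : ℕ} (h : NerveChain A W S F i) : Disjoint S F := by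
  induction h with
  | start hi _ _ => simpa using hi
  | step _ hj _ _ ih => exact Finset.disjoint_insert_right.2 ⟨hj, ih⟩

/-- Initial segments of a chain are chains; hence an unreached index lies on no chain and may be
appended without repetition. -/
theorem exists_of_mem {F : Finset ℕ} {i k : ℕ} (h : NerveChain A W S F i) (hk : k ∈ F) :
    ∃ F', NerveChain A W S F' k := by
  induction h with
  | start hi hj h =>
    obtain rfl := Finset.mem_singleton.1 hk
    exact ⟨_, start hi hj h⟩
  | step hF hj hjF h ih =>
    rcases Finset.mem_insert.1 hk with rfl | hk
    · exact ⟨_, step hF hj hjF h⟩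
    · exact ih hk

/-- In an open cover of a connected set, every member that meets the set is reached by a chain. -/
theorem exists_of_isPreconnected [TopologicalSpace X] (hA : IsPreconnected A)
    (hW : ∀ i, IsOpen (W i)) (hcov : A ⊆ ⋃ i, W i) {j : ℕ} (hj : j ∈ S)
    (hjA : (A ∩ W j).Nonempty) {i : ℕ} (hiA : (A ∩ W i).Nonempty) :
    i ∈ S ∨ ∃ F, NerveChain A W S F i := by
  by_contra hi
  -- The reached and the unreached members form two open sets covering A. A common point in A would
  -- extend a chain to an unreached index.
  let K : Set ℕ := {k | k ∈ S ∨ ∃ F, NerveChain A W S F k}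
  obtain ⟨x, hxA, hx, hx'⟩ := hA (⋃ k ∈ K, W k) (⋃ k ∈ Kᶜ, W k)
    (isOpen_biUnion fun k _ => hW k) (isOpen_biUnion fun k _ => hW k)
    (by
      intro x hx
      obtain ⟨k, hk⟩ := Set.mem_iUnion.1 (hcov hx)
      by_cases hkK : k ∈ K
      · exact Or.inl (Set.mem_biUnion hkK hk)
      · exact Or.inr (Set.mem_biUnion hkK hk))
    (hjA.mono (Set.inter_subset_inter_right _ (Set.subset_biUnion_of_mem (u := W) (Or.inl hj))))
    (hiA.mono (Set.inter_subset_inter_right _ (Set.subset_biUnion_of_mem (u := W) hi)))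
  obtain ⟨k, hk, hxk⟩ := Set.mem_iUnion₂.1 hx
  obtain ⟨m, hm, hxm⟩ := Set.mem_iUnion₂.1 hx'
  have hmS : m ∉ S := fun h => hm (Or.inl h)
  rcases hk with hk | ⟨F, hF⟩
  · exact hm (Or.inr ⟨_, start hmS hk ⟨x, hxA, hxm, hxk⟩⟩)
  · exact hm (Or.inr ⟨_, step hF hmS (fun h => hm (Or.inr (hF.exists_of_mem h)))
      ⟨x, hxA, hxk, hxm⟩⟩)

/-- A chain of sets carries a tree in `A` that meets all its members, contains a given point
of the last one, and has its root in a member indexed by `S`. -/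
theorem exists_metricTree {X : Type*} [MetricSpace X] {A : Set X} {W : ℕ → Set X} {S : Finset ℕ}
    {F : Finset ℕ} {i : ℕ} (h : NerveChain A W S F i) {p : X} (hpA : p ∈ A) (hp : p ∈ W i) :
    ∃ (q : X) (V : Set X) (l : ℝ≥0∞), MetricTree q V l ∧ p ∈ V ∧ V ⊆ A ∧
      (∃ j ∈ S, q ∈ W j) ∧ (∀ k ∈ F, (V ∩ W k).Nonempty) ∧
      l ≤ ∑ k ∈ F, Metric.ediam (W k) := by
  induction h generalizing p with
  | @start i j hi hj h =>
    obtain ⟨q, hqA, hqi, hqj⟩ := h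
    refine ⟨q, _, _, (MetricTree.single q).attach_leaf (x := p) rfl, Set.mem_insert _ _, ?_,
      ⟨j, hj, hqj⟩, ?_, ?_⟩
    · exact Set.insert_subset hpA (Set.singleton_subset_iff.2 hqA)
    · intro k hk
      obtain rfl := Finset.mem_singleton.1 hk
      exact ⟨p, Set.mem_insert _ _, hp⟩
    · simpa using Metric.edist_le_ediam_of_mem hqi hp
  | @step F i j hF hj hjF h ih =>
    -- The shorter chain is made to end at z; the new edge from z to p lies in W j and is paid for
    -- by its diameter.
    obtain ⟨z, hzA, hzi, hzj⟩ := h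
    obtain ⟨q, V, l, ht, hzV, hVA, hq, hV, hl⟩ := ih hzA hzi
    refine ⟨q, _, _, ht.attach_leaf (x := p) hzV, Set.mem_insert _ _,
      Set.insert_subset hpA hVA, hq, ?_, ?_⟩
    · intro k hk
      rcases Finset.mem_insert.1 hk with rfl | hk
      · exact ⟨p, Set.mem_insert _ _, hp⟩
      · exact (hV k hk).mono (Set.inter_subset_inter_left _ (Set.subset_insert _ _))
    · rw [Finset.sum_insert hjF, add_comm]
      exact add_le_add (Metric.edist_le_ediam_of_mem hzj hp) hl

end NerveChain

/-! ### Short trees in connected sets -/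

section Connected

variable {X : Type*} [MetricSpace X]

/-- A finite subset `P` of a connected set with an open cover by sets of diameter at most `δ` lies
on a tree whose length exceeds the sum of the diameters by at most `δ` for each point of `P`. -/
theorem exists_metricTree_of_open_cover {A : Set X} (hA : IsPreconnected A) {W : ℕ → Set X}
    (hW : ∀ i, IsOpen (W i)) (hcov : A ⊆ ⋃ i, W i) {δ : ℝ≥0∞}
    (hδ : ∀ i, Metric.ediam (W i) ≤ δ) {P : Finset X} (hne : P.Nonempty) (hP : (P : Set X) ⊆ A) :
    ∃ (r : X) (V : Set X) (l : ℝ≥0∞) (S : Finset ℕ), MetricTree r V l ∧ (P : Set X) ⊆ V ∧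
      V ⊆ A ∧ S.Nonempty ∧ (∀ k ∈ S, (V ∩ W k).Nonempty) ∧
      l ≤ ∑ k ∈ S, Metric.ediam (W k) + P.card * δ := by
  induction hne using Finset.Nonempty.cons_induction with
  | singleton p =>
    have hpA : p ∈ A := hP (by simp)
    obtain ⟨i, hi⟩ := Set.mem_iUnion.1 (hcov hpA)
    refine ⟨p, {p}, 0, {i}, .single p, by simp, by simpa using hpA, by simp, ?_, zero_le⟩
    intro k hk
    obtain rfl := Finset.mem_singleton.1 hk
    exact ⟨p, rfl, hi⟩
  | cons p P hp hne ih =>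
    rw [Finset.coe_cons, Set.insert_subset_iff] at hP
    obtain ⟨hpA, hPA⟩ := hP
    obtain ⟨r, V, l, S, ht, hPV, hVA, ⟨j, hj⟩, hS, hl⟩ := ih hPA
    obtain ⟨i, hi⟩ := Set.mem_iUnion.1 (hcov hpA)
    have hjA : (A ∩ W j).Nonempty := (hS j hj).mono (Set.inter_subset_inter_left _ hVA)
    rw [Finset.coe_cons, Finset.card_cons, Nat.cast_add, Nat.cast_one, add_mul, one_mul]
    -- S records the members already charged, each met by V. If S contains i, then p is joined
    -- inside W i at cost δ. Otherwise the chain charges only new indices, and its tree is joined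
    -- inside W m at cost δ.
    rcases NerveChain.exists_of_isPreconnected hA hW hcov hj hjA ⟨p, hpA, hi⟩ with hiS | ⟨F, hF⟩
    · obtain ⟨v, hvV, hvi⟩ := hS i hiS
      refine ⟨r, _, _, S, ht.attach_leaf (x := p) hvV, Set.insert_subset_insert hPV,
        Set.insert_subset hpA hVA, ⟨j, hj⟩, ?_, ?_⟩
      · exact fun k hk => (hS k hk).mono (Set.inter_subset_inter_left _ (Set.subset_insert _ _))
      · rw [← add_assoc]
        exact add_le_add hl ((Metric.edist_le_ediam_of_mem hvi hi).trans (hδ i))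
    · obtain ⟨q, V', l', ht', hpV', hVA', ⟨m, hm, hqm⟩, hF', hl'⟩ := hF.exists_metricTree hpA hi
      obtain ⟨v, hvV, hvm⟩ := hS m hm
      refine ⟨r, _, _, S ∪ F, ht.attach hvV ht', ?_, Set.union_subset hVA hVA',
        ⟨j, Finset.mem_union_left _ hj⟩, ?_, ?_⟩
      · exact Set.insert_subset (Or.inr hpV') (hPV.trans Set.subset_union_left)
      · intro k hk
        rcases Finset.mem_union.1 hk with hk | hk
        · exact (hS k hk).mono (Set.inter_subset_inter_left _ Set.subset_union_left)
        · exact (hF' k hk).mono (Set.inter_subset_inter_left _ Set.subset_union_right)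
      · rw [Finset.sum_union hF.disjoint]
        calc l + l' + edist v q
            ≤ (∑ k ∈ S, Metric.ediam (W k) + P.card * δ) + ∑ k ∈ F, Metric.ediam (W k) + δ :=
              add_le_add (add_le_add hl hl') ((Metric.edist_le_ediam_of_mem hvm hqm).trans (hδ m))
          _ = _ := by ring

theorem smtIn_le_tsum {A : Set X} (hA : IsPreconnected A) {W : ℕ → Set X}
    (hW : ∀ i, IsOpen (W i)) (hcov : A ⊆ ⋃ i, W i) {δ : ℝ≥0∞}
    (hδ : ∀ i, Metric.ediam (W i) ≤ δ) {P : Finset X} (hne : P.Nonempty) (hP : (P : Set X) ⊆ A) :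
    smtIn A P ≤ ∑' i, Metric.ediam (W i) + P.card * δ := by
  obtain ⟨r, V, l, S, ht, hPV, hVA, -, -, hl⟩ :=
    exists_metricTree_of_open_cover hA hW hcov hδ hne hP
  exact (ht.smtIn_le hPV hVA).trans (hl.trans (add_le_add (ENNReal.sum_le_tsum S) le_rfl))

/-- Covers can be replaced by open covers at an arbitrarily small cost. -/
theorem exists_open_cover {A : Set X} {δ : ℝ≥0} {c : ℝ≥0∞} (h : outerLinearPremeasure δ A < c)
    {ε : ℝ≥0} (hε : 0 < ε) :
    ∃ W : ℕ → Set X, (∀ i, IsOpen (W i)) ∧ A ⊆ ⋃ i, W i ∧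
      (∀ i, Metric.ediam (W i) ≤ δ + 2 * ε) ∧ ∑' i, Metric.ediam (W i) ≤ c + 2 * ε := by
  simp only [outerLinearPremeasure, iInf_lt_iff] at h
  obtain ⟨U, hU, hd, hs⟩ := h
  obtain ⟨η, hη, hηs⟩ := ENNReal.exists_pos_sum_of_countable (ε := ε) (by simpa using hε.ne') ℕ
  have hη' : ∀ i, (η i : ℝ≥0∞) ≤ ε := fun i =>
    (ENNReal.le_tsum (f := fun i => (η i : ℝ≥0∞)) i).trans hηs.le
  have hth : ∀ i, Metric.ediam (Metric.thickening (η i) (U i)) ≤ Metric.ediam (U i) + 2 * η i :=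
    fun i => Metric.ediam_thickening_le _
  refine ⟨fun i => Metric.thickening (η i) (U i), fun i => Metric.isOpen_thickening, ?_, ?_, ?_⟩
  · exact hU.trans (Set.iUnion_mono fun i => Metric.self_subset_thickening (hη i) _)
  · exact fun i => (hth i).trans (add_le_add (hd i) (mul_le_mul_right (hη' i) _))
  · refine (ENNReal.tsum_le_tsum hth).trans ?_
    rw [ENNReal.tsum_add, ENNReal.tsum_mul_left]
    exact add_le_add hs.le (mul_le_mul_right hηs.le _)

theorem intrinsicMengerLength_le_outerLinearMeasure {A : Set X} (hA : IsPreconnected A) :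
    intrinsicMengerLength A ≤ outerLinearMeasure A := by
  refine iSup_le fun P => iSup₂_le fun hne hP => ?_
  refine ENNReal.le_of_forall_pos_le_add fun ε hε hfin => ?_
  have hden : (0 : ℝ≥0) < 3 + 3 * P.card := by positivity
  -- The error is η for strictness and 2η for thickening; each point of P adds the mesh η + 2η.
  set η : ℝ≥0 := ε / (3 + 3 * P.card) with hη
  have hη0 : 0 < η := div_pos hε hden
  have hlt : outerLinearPremeasure η A < outerLinearMeasure A + η :=
    (le_iSup₂_of_le (f := fun (δ : ℝ≥0) (_ : 0 < δ) => outerLinearPremeasure δ A) η hη0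
      le_rfl).trans_lt (ENNReal.lt_add_right hfin.ne (by simpa using hη0.ne'))
  obtain ⟨W, hW, hcov, hd, hs⟩ := exists_open_cover hlt hη0
  have hηε : (3 + 3 * P.card) * η = ε := mul_div_cancel₀ _ hden.ne'
  calc smtIn A P ≤ ∑' i, Metric.ediam (W i) + P.card * (η + 2 * η) :=
        smtIn_le_tsum hA hW hcov hd hne hP
    _ ≤ outerLinearMeasure A + η + 2 * η + P.card * (η + 2 * η) := add_le_add hs le_rfl
    _ = outerLinearMeasure A + (3 + 3 * P.card) * η := by ring
    _ = outerLinearMeasure A + ε := by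
        rw [← hηε]
        push_cast
        rfl

end Connected

/-- `IsPreconnected` is topological connectedness with the empty set allowed. -/
theorem mainTheorem1 {X : Type*} [MetricSpace X] (A : Set X) :
    (outerLinearMeasure A ≤ mengerChoquetLength A ∧
      mengerChoquetLength A ≤ intrinsicMengerLength A) ∧
    (IsPreconnected A →
      outerLinearMeasure A = mengerChoquetLength A ∧
        mengerChoquetLength A = intrinsicMengerLength A) := by
  have h₁ := outerLinearMeasure_le_mengerChoquetLength A
  have h₂ := mengerChoquetLength_le_intrinsicMengerLength A
  refine ⟨⟨h₁, h₂⟩, fun hA => ?_⟩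
  have h₃ := intrinsicMengerLength_le_outerLinearMeasure hA
  exact ⟨h₁.antisymm (h₂.trans h₃), h₂.antisymm (h₃.trans h₁)⟩
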